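/- Let $k$ be an algebraically closed field of characteristic $p>0$. For a homomorphism of algebraic groups $\sigma:\mathrm{SL}(2,k)\to\mathrm{SL}(n,k)$, regard the column space $V(n)=k^n$ as an $\mathrm{SL}(2,k)$-module via $\sigma$, and call $\sigma$ indecomposable if this module is indecomposable (nonzero and not a direct sum of two nonzero submodules). For $\sigma:\mathrm{SL}(2,k)\to\mathrm{SL}(m,k)$ and $\tau:\mathrm{SL}(2,k)\to\mathrm{SL}(n,k)$ let $\sigma\oplus\tau:\mathrm{SL}(2,k)\to\mathrm{SL}(m+n,k)$ be the block-diagonal homomorphism $A\mapsto\mathrm{diag}(\sigma(A),\tau(A))$. An expression of $\sigma$ as a direct sum of indecomposable homomorphisms is called an indecomposable decomposition of $\sigma$. For $A=\begin{pmatrix}a&b\\c&d\end{pmatrix}\in\mathrm{SL}(2,k)$ and integers $e\ge0$, write $q=p^e$ and define homomorphisms as follows. * $\sigma^{(1)}(A)=I_1$, $\quad\sigma^{(2.1)}_e(A)=\begin{pmatrix}a^{q}&b^{q}\\c^{q}&d^{q}\end{pmatrix}$, $\quad\sigma^{(2.2)}(A)=I_2$. * If $p=2$: $\sigma^{(3.1.a)}_e(A)=\begin{pmatrix}a^{pq}&b^{pq}&0\\c^{pq}&d^{pq}&0\\a^{q}c^{q}&b^{q}d^{q}&1\end{pmatrix}$,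 $\quad\sigma^{(3.1.b)}_e(A)=\begin{pmatrix}a^{pq}&b^{pq}&a^{q}b^{q}\\c^{pq}&d^{pq}&c^{q}d^{q}\\0&0&1\end{pmatrix}$, $\quad\sigma^{(3.1.c)}_e(A)=\begin{pmatrix}a^{q}&b^{q}&0\\c^{q}&d^{q}&0\\0&0&1\end{pmatrix}$, $\quad\sigma^{(3.1.d)}(A)=I_3$. * If $p\ge3$: $\sigma^{(3.2.a)}_e(A)=\begin{pmatrix}a^{2q}&a^{q}b^{q}&b^{2q}\\2a^{q}c^{q}&a^{q}d^{q}+b^{q}c^{q}&2b^{q}d^{q}\\c^{2q}&c^{q}d^{q}&d^{2q}\end{pmatrix}$, $\quad\sigma^{(3.2.b)}_e(A)=\begin{pmatrix}a^{q}&b^{q}&0\\c^{q}&d^{q}&0\\0&0&1\end{pmatrix}$, $\quad\sigma^{(3.2.c)}(A)=I_3$. **Theorem 7.3.** The following hold. 1. $\sigma^{(1)}$ is indecomposable. 2. For every integer $e\ge0$, $\sigma^{(2.1)}_e$ is indecomposable; and $\sigma^{(2.2)}$ has the indecomposable decomposition $\sigma^{(2.2)}=\sigma^{(1)}\oplus\sigma^{(1)}$.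 3. (3.1) If $p=2$, then for every integer $e\ge0$: (a) $\sigma^{(3.1.a)}_e$ is indecomposable; (b) $\sigma^{(3.1.b)}_e$ is indecomposable; (c) $\sigma^{(3.1.c)}_e$ has the indecomposable decomposition $\sigma^{(3.1.c)}_e=\sigma^{(2.1)}_e\oplus\sigma^{(1)}$; (d) $\sigma^{(3.1.d)}$ has the indecomposable decomposition $\sigma^{(3.1.d)}=\sigma^{(1)}\oplus\sigma^{(1)}\oplus\sigma^{(1)}$. (3.2) If $p\ge3$, then for every integer $e\ge0$: (a) $\sigma^{(3.2.a)}_e$ is indecomposable; (b) $\sigma^{(3.2.b)}_e$ has the indecomposable decomposition $\sigma^{(3.2.b)}_e=\sigma^{(2.1)}_e\oplus\sigma^{(1)}$; (c) $\sigma^{(3.2.c)}$ has the indecomposable decomposition $\sigma^{(3.2.c)}=\sigma^{(1)}\oplus\sigma^{(1)}\oplus\sigma^{(1)}$. -/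

import Mathlib

open scoped MatrixGroups

/-- A function on `SL(m, k)` is regular if it is given by a polynomial over `k` in the entries.
For algebraically closed `k` these are exactly the regular functions of the affine variety
`SL(m, k)`. -/
def IsRegularFun {k : Type*} [Field k] {m : ℕ} (f : SL(m, k) → k) : Prop :=
  ∃ P : MvPolynomial (Fin m × Fin m) k, ∀ A : SL(m, k), f A = MvPolynomial.eval (fun i => A i.1 i.2) P

namespace IsRegularFun

variable {k : Type*} [Field k] {m : ℕ} {f g : SL(m, k) → k}

theorem const (c : k) : IsRegularFun (fun _ : SL(m, k) => c) :=
  ⟨MvPolynomial.C c, fun A => by simp⟩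

theorem entry (i j : Fin m) : IsRegularFun (fun A : SL(m, k) => A i j) :=
  ⟨MvPolynomial.X (i, j), fun A => by simp⟩

theorem add (hf : IsRegularFun f) (hg : IsRegularFun g) : IsRegularFun (fun A => f A + g A) := by
  obtain ⟨P, hP⟩ := hf
  obtain ⟨Q, hQ⟩ := hg
  exact ⟨P + Q, fun A => by simp [hP, hQ]⟩

theorem mul (hf : IsRegularFun f) (hg : IsRegularFun g) : IsRegularFun (fun A => f A * g A) := by
  obtain ⟨P, hP⟩ := hf
  obtain ⟨Q, hQ⟩ := hg
  exact ⟨P * Q, fun A => by simp [hP, hQ]⟩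

theorem pow (hf : IsRegularFun f) (r : ℕ) : IsRegularFun (fun A => f A ^ r) := by
  obtain ⟨P, hP⟩ := hf
  exact ⟨P ^ r, fun A => by simp [hP]⟩

theorem entry_pow (i j : Fin m) (r : ℕ) : IsRegularFun (fun A : SL(m, k) => A i j ^ r) :=
  (entry i j).pow r

end IsRegularFun

/-- Homomorphisms of algebraic groups `SL(m, k) → SL(n, k)` (on `k`-points, `k` being algebraically
closed in the application): group homomorphisms all of whose matrix entries are regular. -/
@[ext]
structure SLHom (k : Type*) [Field k] (m n : ℕ) where
  toMonoidHom : SL(m, k) →* SL(n, k)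
  regular : ∀ i j : Fin n, IsRegularFun (fun A => toMonoidHom A i j)

namespace SLHom

variable {k : Type*} [Field k] {m n n' : ℕ}

/-- A homomorphism from a matrix-valued function with determinant one. -/
def ofMatrix (M : SL(m, k) → Matrix (Fin n) (Fin n) k) (hdet : ∀ A, (M A).det = 1)
    (hmul : ∀ A B, M (A * B) = M A * M B)
    (hreg : ∀ i j, IsRegularFun (fun A => M A i j)) : SLHom k m n where
  toMonoidHom := MonoidHom.mk' (fun A => ⟨M A, hdet A⟩) fun A B => Subtype.ext (hmul A B)
  regular := hreg

/-- The representation of `SL(m, k)` on the column vectors `V(n) = k ^ n`,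
where `A` acts by `v ↦ σ(A) v`. -/
def rep (σ : SLHom k m n) : Representation k SL(m, k) (Fin n → k) where
  toFun A := Matrix.toLin' (σ.toMonoidHom A : Matrix (Fin n) (Fin n) k)
  map_one' := by simp [Module.End.one_eq_id]
  map_mul' A B := by simp [Matrix.toLin'_mul, Module.End.mul_eq_comp]

/-- `σ` is indecomposable if the module `V(n)` is nonzero and is not the direct sum
of two nonzero submodules. -/
def IsIndecomposable (σ : SLHom k m n) : Prop :=
  Nontrivial (Fin n → k) ∧ ∀ U W : Subrepresentation σ.rep, IsCompl U W → U = ⊥ ∨ W = ⊥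

/-- The direct sum of homomorphisms: `A ↦ diag(σ(A), τ(A))` (block diagonal). -/
def directSum (σ : SLHom k m n) (τ : SLHom k m n') : SLHom k m (n + n') :=
  ofMatrix
    (fun A => Matrix.reindex finSumFinEquiv finSumFinEquiv
      (Matrix.fromBlocks (σ.toMonoidHom A : Matrix (Fin n) (Fin n) k) 0 0
        (τ.toMonoidHom A : Matrix (Fin n') (Fin n') k)))
    (fun A => by rw [Matrix.det_reindex_self, Matrix.det_fromBlocks_zero₂₁]; simp)
    (fun A B => by
      simp only [Matrix.reindex_apply, map_mul, Matrix.SpecialLinearGroup.coe_mul,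
        Matrix.submatrix_mul_equiv, Matrix.fromBlocks_multiply]
      simp)
    (fun i j => by
      simp only [Matrix.reindex_apply, Matrix.submatrix_apply]
      rcases finSumFinEquiv.symm i with i | i <;> rcases finSumFinEquiv.symm j with j | j <;>
        simp only [Matrix.fromBlocks_apply₁₁, Matrix.fromBlocks_apply₁₂,
          Matrix.fromBlocks_apply₂₁, Matrix.fromBlocks_apply₂₂, Matrix.zero_apply]
      · exact σ.regular i j
      · exact .const 0
      · exact .const 0
      · exact τ.regular i j)

/-- The trivial homomorphism `A ↦ I_n`. -/
def triv (k : Type*) [Field k] (m n : ℕ) : SLHom k m n :=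
  ofMatrix (fun _ => 1) (fun _ => Matrix.det_one) (fun _ _ => (one_mul 1).symm)
    (fun i j => .const ((1 : Matrix (Fin n) (Fin n) k) i j))

end SLHom

section

open Matrix

variable (k : Type*) [Field k]

theorem det_entries {k : Type*} [Field k] (A : SL(2, k)) : A 0 0 * A 1 1 - A 0 1 * A 1 0 = 1 := by
  have h := A.det_coe
  rwa [Matrix.det_fin_two] at h

theorem det_entries_pow {k : Type*} [Field k] (p : ℕ) [Fact p.Prime] [CharP k p] (e : ℕ)
    (A : SL(2, k)) :
    A 0 0 ^ p ^ e * A 1 1 ^ p ^ e - A 0 1 ^ p ^ e * A 1 0 ^ p ^ e = 1 := by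
  rw [← mul_pow, ← mul_pow, ← sub_pow_char_pow, det_entries, one_pow]

theorem mul_entries_pow {k : Type*} [Field k] (p : ℕ) [Fact p.Prime] [CharP k p] (e : ℕ)
    (A B : SL(2, k)) (i j : Fin 2) :
    (A * B) i j ^ p ^ e = A i 0 ^ p ^ e * B 0 j ^ p ^ e + A i 1 ^ p ^ e * B 1 j ^ p ^ e := by
  rw [Matrix.SpecialLinearGroup.coe_mul, Matrix.mul_apply, Fin.sum_univ_two, add_pow_char_pow,
    mul_pow, mul_pow]

/-- `σ^(1) : SL(2, k) → SL(1, k)`, the trivial homomorphism. -/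
def sigma1 : SLHom k 2 1 := SLHom.triv k 2 1

/-- `σ^(2.1)_e : SL(2, k) → SL(2, k)`, the `e`-th power of Frobenius on the entries. -/
def sigma21 (p : ℕ) [Fact p.Prime] [CharP k p] (e : ℕ) : SLHom k 2 2 :=
  .ofMatrix
    (fun A => !![A 0 0 ^ p ^ e, A 0 1 ^ p ^ e; A 1 0 ^ p ^ e, A 1 1 ^ p ^ e])
    (fun A => by rw [Matrix.det_fin_two_of, det_entries_pow])
    (fun A B => by
      simp only [mul_entries_pow]
      ext i j; fin_cases i <;> fin_cases j <;> simp [Matrix.mul_apply, Fin.sum_univ_two])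
    (fun i j => by
      fin_cases i <;> fin_cases j <;> exact .entry_pow _ _ _)

/-- `σ^(2.2) : SL(2, k) → SL(2, k)`, the trivial homomorphism. -/
def sigma22 : SLHom k 2 2 := SLHom.triv k 2 2

/-- `σ^(3.1.a)_e : SL(2, k) → SL(3, k)`, defined for `p = 2`. -/
def sigma31a (p : ℕ) [Fact p.Prime] [CharP k p] (hp : p = 2) (e : ℕ) : SLHom k 2 3 :=
  .ofMatrix
    (fun A => !![A 0 0 ^ p ^ (e + 1), A 0 1 ^ p ^ (e + 1), 0;
                 A 1 0 ^ p ^ (e + 1), A 1 1 ^ p ^ (e + 1), 0;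
                 A 0 0 ^ p ^ e * A 1 0 ^ p ^ e, A 0 1 ^ p ^ e * A 1 1 ^ p ^ e, 1])
    (fun A => by
      have h := det_entries_pow p (e + 1) A
      rw [Matrix.det_fin_three]
      simp
      linear_combination h)
    (fun A B => by
      subst hp
      have h2 : (2 : k) = 0 := CharP.cast_eq_zero k 2
      have h := det_entries_pow 2 e A
      simp only [mul_entries_pow]
      ext i j; fin_cases i <;> fin_cases j <;> simp [Matrix.mul_apply, Fin.sum_univ_three]
      · simp only [pow_succ 2 e, pow_mul]
        linear_combination (B 0 0 ^ 2 ^ e * B 1 0 ^ 2 ^ e) * h +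
          (B 0 0 ^ 2 ^ e * B 1 0 ^ 2 ^ e * A 0 1 ^ 2 ^ e * A 1 0 ^ 2 ^ e) * h2
      · simp only [pow_succ 2 e, pow_mul]
        linear_combination (B 0 1 ^ 2 ^ e * B 1 1 ^ 2 ^ e) * h +
          (B 0 1 ^ 2 ^ e * B 1 1 ^ 2 ^ e * A 0 1 ^ 2 ^ e * A 1 0 ^ 2 ^ e) * h2)
    (fun i j => by
      fin_cases i <;> fin_cases j <;> first
        | exact .entry_pow _ _ _
        | exact (IsRegularFun.entry_pow _ _ _).mul (.entry_pow _ _ _)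
        | exact .const _)

/-- `σ^(3.1.b)_e : SL(2, k) → SL(3, k)`, defined for `p = 2`. -/
def sigma31b (p : ℕ) [Fact p.Prime] [CharP k p] (hp : p = 2) (e : ℕ) : SLHom k 2 3 :=
  .ofMatrix
    (fun A => !![A 0 0 ^ p ^ (e + 1), A 0 1 ^ p ^ (e + 1), A 0 0 ^ p ^ e * A 0 1 ^ p ^ e;
                 A 1 0 ^ p ^ (e + 1), A 1 1 ^ p ^ (e + 1), A 1 0 ^ p ^ e * A 1 1 ^ p ^ e;
                 0, 0, 1])
    (fun A => by
      have h := det_entries_pow p (e + 1) A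
      rw [Matrix.det_fin_three]
      simp
      linear_combination h)
    (fun A B => by
      subst hp
      have h2 : (2 : k) = 0 := CharP.cast_eq_zero k 2
      have h := det_entries_pow 2 e B
      simp only [mul_entries_pow]
      ext i j; fin_cases i <;> fin_cases j <;> simp [Matrix.mul_apply, Fin.sum_univ_three]
      · simp only [pow_succ 2 e, pow_mul]
        linear_combination (A 0 0 ^ 2 ^ e * A 0 1 ^ 2 ^ e) * h +
          (A 0 0 ^ 2 ^ e * A 0 1 ^ 2 ^ e * B 0 1 ^ 2 ^ e * B 1 0 ^ 2 ^ e) * h2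
      · simp only [pow_succ 2 e, pow_mul]
        linear_combination (A 1 0 ^ 2 ^ e * A 1 1 ^ 2 ^ e) * h +
          (A 1 0 ^ 2 ^ e * A 1 1 ^ 2 ^ e * B 0 1 ^ 2 ^ e * B 1 0 ^ 2 ^ e) * h2)
    (fun i j => by
      fin_cases i <;> fin_cases j <;> first
        | exact .entry_pow _ _ _
        | exact (IsRegularFun.entry_pow _ _ _).mul (.entry_pow _ _ _)
        | exact .const _)

/-- `σ^(3.1.c)_e : SL(2, k) → SL(3, k)` (used for `p = 2`). -/
def sigma31c (p : ℕ) [Fact p.Prime] [CharP k p] (e : ℕ) : SLHom k 2 3 :=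
  .ofMatrix
    (fun A => !![A 0 0 ^ p ^ e, A 0 1 ^ p ^ e, 0;
                 A 1 0 ^ p ^ e, A 1 1 ^ p ^ e, 0;
                 0, 0, 1])
    (fun A => by
      have h := det_entries_pow p e A
      rw [Matrix.det_fin_three]
      simp
      linear_combination h)
    (fun A B => by
      simp only [mul_entries_pow]
      ext i j; fin_cases i <;> fin_cases j <;> simp [Matrix.mul_apply, Fin.sum_univ_three])
    (fun i j => by
      fin_cases i <;> fin_cases j <;> first
        | exact .entry_pow _ _ _
        | exact .const _)

/-- `σ^(3.1.d) : SL(2, k) → SL(3, k)`, the trivial homomorphism (used for `p = 2`). -/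
def sigma31d : SLHom k 2 3 := SLHom.triv k 2 3

/-- `σ^(3.2.a)_e : SL(2, k) → SL(3, k)` (used for `p ≥ 3`). -/
def sigma32a (p : ℕ) [Fact p.Prime] [CharP k p] (e : ℕ) : SLHom k 2 3 :=
  .ofMatrix
    (fun A => !![A 0 0 ^ (2 * p ^ e), A 0 0 ^ p ^ e * A 0 1 ^ p ^ e, A 0 1 ^ (2 * p ^ e);
                 2 * A 0 0 ^ p ^ e * A 1 0 ^ p ^ e,
                   A 0 0 ^ p ^ e * A 1 1 ^ p ^ e + A 0 1 ^ p ^ e * A 1 0 ^ p ^ e,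
                   2 * A 0 1 ^ p ^ e * A 1 1 ^ p ^ e;
                 A 1 0 ^ (2 * p ^ e), A 1 0 ^ p ^ e * A 1 1 ^ p ^ e, A 1 1 ^ (2 * p ^ e)])
    (fun A => by
      have h := det_entries_pow p e A
      rw [Matrix.det_fin_three]
      simp only [mul_comm 2 (p ^ e), pow_mul]
      simp
      generalize A 0 0 ^ p ^ e = a at *
      generalize A 0 1 ^ p ^ e = b at *
      generalize A 1 0 ^ p ^ e = c at *
      generalize A 1 1 ^ p ^ e = d at *
      linear_combination ((a * d - b * c) ^ 2 + (a * d - b * c) + 1) * h)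
    (fun A B => by
      simp only [mul_comm 2 (p ^ e), pow_mul, mul_entries_pow]
      ext i j
      fin_cases i <;> fin_cases j <;> simp [Matrix.mul_apply, Fin.sum_univ_three] <;> ring)
    (fun i j => by
      fin_cases i <;> fin_cases j <;> first
        | exact .entry_pow _ _ _
        | exact (IsRegularFun.entry_pow _ _ _).mul (.entry_pow _ _ _)
        | exact ((IsRegularFun.const _).mul (.entry_pow _ _ _)).mul (.entry_pow _ _ _)
        | exact ((IsRegularFun.entry_pow _ _ _).mul (.entry_pow _ _ _)).add
            ((IsRegularFun.entry_pow _ _ _).mul (.entry_pow _ _ _)))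

/-- `σ^(3.2.b)_e : SL(2, k) → SL(3, k)` (used for `p ≥ 3`); the matrix formula is that
of `σ^(3.1.c)_e`. -/
def sigma32b (p : ℕ) [Fact p.Prime] [CharP k p] (e : ℕ) : SLHom k 2 3 := sigma31c k p e

/-- `σ^(3.2.c) : SL(2, k) → SL(3, k)`, the trivial homomorphism (used for `p ≥ 3`). -/
def sigma32c : SLHom k 2 3 := SLHom.triv k 2 3

end

/-! Each module claimed to be indecomposable has a simple socle: some nonzero vector `e` lies in
every nonzero submodule, so no two nonzero submodules are complementary (`isIndecomposable_of_mem`).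
To reach `e` from a nonzero `v` in a submodule `U`, apply `σ(u) - 1` with `u` unipotent. This stays
in `U` (`mulVec_sub_mem`) and kills coordinates of `v`; one or two such operators, combined
linearly, leave a nonzero multiple of `e`. The matrices of the decomposable homomorphisms are
already block diagonal, so those decompositions are equalities checked on entries. -/

namespace SLHom

variable {k : Type*} [Field k] {m n : ℕ}

/-- A homomorphism is indecomposable if some nonzero vector lies in every nonzero submodule. -/
theorem isIndecomposable_of_mem {σ : SLHom k m n} {e : Fin n → k} (he : e ≠ 0)
    (h : ∀ U : Subrepresentation σ.rep, ∀ v ∈ U, v ≠ 0 → e ∈ U) : σ.IsIndecomposable := by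
  have key : ∀ U : Subrepresentation σ.rep, U ≠ ⊥ → e ∈ U := fun U hU => by
    by_contra hmem
    refine hU (SetLike.ext fun v => ⟨fun hv => ?_, fun hv => ?_⟩)
    · by_contra hv0
      exact hmem (h U v hv hv0)
    · have hv0 : v = 0 := hv
      rw [hv0]
      exact U.toSubmodule.zero_mem
  refine ⟨nontrivial_of_ne e 0 he, fun U W hUW => ?_⟩
  by_contra! hne
  have : e ∈ U ⊓ W := ⟨key U hne.1, key W hne.2⟩
  rw [hUW.inf_eq_bot] at this
  exact he this

/-- A submodule is stable under `v ↦ σ(A) v - v`. -/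
theorem mulVec_sub_mem {σ : SLHom k m n} (U : Subrepresentation σ.rep) (A : SL(m, k))
    {v : Fin n → k} (hv : v ∈ U) :
    (σ.toMonoidHom A : Matrix (Fin n) (Fin n) k).mulVec v - v ∈ U :=
  U.toSubmodule.sub_mem (U.apply_mem_toSubmodule A hv) hv

theorem mem_of_smul_mem {σ : SLHom k m n} (U : Subrepresentation σ.rep) {c : k} (hc : c ≠ 0)
    {v : Fin n → k} (hv : c • v ∈ U) : v ∈ U :=
  (U.toSubmodule.smul_mem_iff hc).1 hv

end SLHom

/-- The upper unitriangular element of `SL(2, k)` with off-diagonal entry `t`. -/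
def upperUnipotent {k : Type*} [Field k] (t : k) : SL(2, k) :=
  ⟨!![1, t; 0, 1], by simp [Matrix.det_fin_two_of]⟩

/-- The lower unitriangular element of `SL(2, k)` with off-diagonal entry `t`. -/
def lowerUnipotent {k : Type*} [Field k] (t : k) : SL(2, k) :=
  ⟨!![1, 0; t, 1], by simp [Matrix.det_fin_two_of]⟩

/-! ### Unipotent action on each module and the resulting indecomposability. -/

section Indecomposability

variable {k : Type*} [Field k]

/-- Lets the Frobenius-twisted parameter of a unipotent matrix take any prescribed value. -/
theorem exists_pow_char_pow_eq [IsAlgClosed k] (p : ℕ) [Fact p.Prime] (e : ℕ) (s : k) :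
    ∃ t : k, t ^ p ^ e = s :=
  IsAlgClosed.exists_pow_nat_eq s (pow_pos (Fact.out : p.Prime).pos e)

/-- An infinite field has an element different from `0` and `1`. -/
theorem exists_ne_zero_ne_one [Infinite k] : ∃ s : k, s ≠ 0 ∧ s ≠ 1 := by
  classical
  obtain ⟨s, hs⟩ := Infinite.exists_notMem_finset ({0, 1} : Finset k)
  exact ⟨s, by simpa using hs⟩

variable (p : ℕ) [Fact p.Prime] [CharP k p] (e : ℕ)

theorem sigma1_isIndecomposable : (sigma1 k).IsIndecomposable := by
  refine SLHom.isIndecomposable_of_mem (e := ![1]) (fun h => by simpa using congrFun h 0)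
    fun U v hv hv0 => ?_
  have h0 : v 0 ≠ 0 := fun h => hv0 (by ext i; fin_cases i; exact h)
  refine SLHom.mem_of_smul_mem U h0 ?_
  convert hv using 1
  ext i; fin_cases i; simp

theorem sigma21_upperUnipotent_mulVec_sub (t : k) (v : Fin 2 → k) :
    ((sigma21 k p e).toMonoidHom (upperUnipotent t) : Matrix _ _ k).mulVec v - v
      = ![t ^ p ^ e * v 1, 0] := by
  -- Needed for `0 ^ p ^ e = 0` in the lower left entry.
  have hp : p ≠ 0 := (Fact.out : p.Prime).ne_zero
  change Matrix.mulVec !![(1 : k) ^ p ^ e, t ^ p ^ e; 0 ^ p ^ e, 1 ^ p ^ e] v - v = _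
  ext i
  fin_cases i <;>
    simp [dotProduct, Fin.sum_univ_two, hp]

theorem sigma21_isIndecomposable : (sigma21 k p e).IsIndecomposable := by
  refine SLHom.isIndecomposable_of_mem (e := ![1, 0]) (fun h => by simpa using congrFun h 0)
    fun U v hv hv0 => ?_
  by_cases h1 : v 1 = 0
  · have h0 : v 0 ≠ 0 := fun h => hv0 (by ext i; fin_cases i <;> simp [h, h1])
    refine SLHom.mem_of_smul_mem U h0 ?_
    convert hv using 1
    ext i; fin_cases i <;> simp [h1]
  · refine SLHom.mem_of_smul_mem U h1 ?_
    have := SLHom.mulVec_sub_mem U (upperUnipotent 1) hv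
    rw [sigma21_upperUnipotent_mulVec_sub] at this
    simpa using this

/-- With `x = t ^ p ^ e`, one coordinate is quadratic in `x` and another linear, so two values of
`x` suffice to separate them. -/
theorem sigma31a_upperUnipotent_mulVec_sub (hp : p = 2) (t : k) (v : Fin 3 → k) :
    ((sigma31a k p hp e).toMonoidHom (upperUnipotent t) : Matrix _ _ k).mulVec v - v
      = ![(t ^ p ^ e) ^ 2 * v 1, 0, t ^ p ^ e * v 1] := by
  subst hp
  change Matrix.mulVec !![(1 : k) ^ 2 ^ (e + 1), t ^ 2 ^ (e + 1), 0; 0 ^ 2 ^ (e + 1), 1 ^ 2 ^ (e + 1), 0;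
    1 ^ 2 ^ e * 0 ^ 2 ^ e, t ^ 2 ^ e * 1 ^ 2 ^ e, 1] v - v = _
  ext i
  fin_cases i <;>
    simp [dotProduct,
      Fin.sum_univ_three, pow_succ 2 e, pow_mul]

theorem sigma31a_lowerUnipotent_mulVec_sub (hp : p = 2) (t : k) (v : Fin 3 → k) :
    ((sigma31a k p hp e).toMonoidHom (lowerUnipotent t) : Matrix _ _ k).mulVec v - v
      = ![0, (t ^ p ^ e) ^ 2 * v 0, t ^ p ^ e * v 0] := by
  subst hp
  change Matrix.mulVec !![(1 : k) ^ 2 ^ (e + 1), 0 ^ 2 ^ (e + 1), 0; t ^ 2 ^ (e + 1), 1 ^ 2 ^ (e + 1), 0;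
    1 ^ 2 ^ e * t ^ 2 ^ e, 0 ^ 2 ^ e * 1 ^ 2 ^ e, 1] v - v = _
  ext i
  fin_cases i <;>
    simp [dotProduct,
      Fin.sum_univ_three, pow_succ 2 e, pow_mul]

/-- The socle is the fixed line of `![0, 0, 1]`. Upper unipotents reach it from any `v` with `v 1 ≠
0`, but they fix every `v` with `v 1 = 0`, where lower unipotents take over. -/
theorem sigma31a_isIndecomposable [IsAlgClosed k] (hp : p = 2) :
    (sigma31a k p hp e).IsIndecomposable := by
  obtain ⟨s, hs0, hs1⟩ := exists_ne_zero_ne_one (k := k)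
  obtain ⟨t, ht⟩ := exists_pow_char_pow_eq p e s
  have hs : s ^ 2 - s ≠ 0 := by
    rw [show s ^ 2 - s = s * (s - 1) by ring]
    exact mul_ne_zero hs0 (sub_ne_zero.2 hs1)
  refine SLHom.isIndecomposable_of_mem (e := ![0, 0, 1]) (fun h => by simpa using congrFun h 2)
    fun U v hv hv0 => ?_
  by_cases h1 : v 1 = 0
  · by_cases h0 : v 0 = 0
    · have h2 : v 2 ≠ 0 := fun h => hv0 (by ext i; fin_cases i <;> simp [h, h0, h1])
      refine SLHom.mem_of_smul_mem U h2 ?_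
      convert hv using 1
      ext i; fin_cases i <;> simp [h0, h1]
    · refine SLHom.mem_of_smul_mem U (mul_ne_zero hs h0) ?_
      have ha := SLHom.mulVec_sub_mem U (lowerUnipotent 1) hv
      have hb := SLHom.mulVec_sub_mem U (lowerUnipotent t) hv
      rw [sigma31a_lowerUnipotent_mulVec_sub] at ha hb
      -- The factor `s ^ 2` cancels the quadratic coordinate, leaving `(s ^ 2 - s) * v 0` in the
      -- last one; this is nonzero because `s` is neither `0` nor `1`.
      have hab : s ^ 2 • _ - _ ∈ U := U.toSubmodule.sub_mem (U.toSubmodule.smul_mem (s ^ 2) ha) hb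
      convert hab using 1
      ext i; fin_cases i <;> simp [ht]
      ring
  · refine SLHom.mem_of_smul_mem U (mul_ne_zero hs h1) ?_
    have ha := SLHom.mulVec_sub_mem U (upperUnipotent 1) hv
    have hb := SLHom.mulVec_sub_mem U (upperUnipotent t) hv
    rw [sigma31a_upperUnipotent_mulVec_sub] at ha hb
    have hab : s ^ 2 • _ - _ ∈ U := U.toSubmodule.sub_mem (U.toSubmodule.smul_mem (s ^ 2) ha) hb
    convert hab using 1
    ext i; fin_cases i <;> simp [ht]
    ring

theorem sigma31b_upperUnipotent_mulVec_sub (hp : p = 2) (t : k) (v : Fin 3 → k) :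
    ((sigma31b k p hp e).toMonoidHom (upperUnipotent t) : Matrix _ _ k).mulVec v - v
      = ![(t ^ p ^ e) ^ 2 * v 1 + t ^ p ^ e * v 2, 0, 0] := by
  subst hp
  change Matrix.mulVec !![(1 : k) ^ 2 ^ (e + 1), t ^ 2 ^ (e + 1), 1 ^ 2 ^ e * t ^ 2 ^ e;
    0 ^ 2 ^ (e + 1), 1 ^ 2 ^ (e + 1), 0 ^ 2 ^ e * 1 ^ 2 ^ e; 0, 0, 1] v - v = _
  ext i
  fin_cases i <;>
    simp [dotProduct,
      Fin.sum_univ_three, pow_succ 2 e, pow_mul]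
  ring

/-- Upper unipotents alone suffice: each moves `v` by a multiple of `![1, 0, 0]`, the multiplier
being `x ^ 2 * v 1 + x * v 2` at `x = t ^ p ^ e`. If it vanishes at both `x = 1` and `x = s`, then
`v 1 = v 2 = 0`, and `v` itself is a multiple of `![1, 0, 0]`. -/
theorem sigma31b_isIndecomposable [IsAlgClosed k] (hp : p = 2) :
    (sigma31b k p hp e).IsIndecomposable := by
  obtain ⟨s, hs0, hs1⟩ := exists_ne_zero_ne_one (k := k)
  obtain ⟨t, ht⟩ := exists_pow_char_pow_eq p e s
  refine SLHom.isIndecomposable_of_mem (e := ![1, 0, 0]) (fun h => by simpa using congrFun h 0)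
    fun U v hv hv0 => ?_
  have hu : ∀ t : k, (t ^ p ^ e) ^ 2 * v 1 + t ^ p ^ e * v 2 ≠ 0 → ![1, 0, 0] ∈ U := fun t h => by
    refine SLHom.mem_of_smul_mem U h ?_
    have := SLHom.mulVec_sub_mem U (upperUnipotent t) hv
    rw [sigma31b_upperUnipotent_mulVec_sub] at this
    simpa using this
  by_contra hmem
  have h12 : v 1 + v 2 = 0 := by
    by_contra h
    exact hmem (hu 1 (by simpa using h))
  have hst : s ^ 2 * v 1 + s * v 2 = 0 := by
    by_contra h
    exact hmem (hu t (by rwa [ht]))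
  have h1 : v 1 = 0 := by
    have : s * (s - 1) * v 1 = 0 := by linear_combination hst - s * h12
    simpa [hs0, sub_ne_zero.2 hs1] using this
  have h2 : v 2 = 0 := by simpa [h1] using h12
  have h0 : v 0 ≠ 0 := fun h => hv0 (by ext i; fin_cases i <;> simp [h, h1, h2])
  refine hmem (SLHom.mem_of_smul_mem U h0 ?_)
  convert hv using 1
  ext i; fin_cases i <;> simp [h1, h2]

theorem sigma32a_upperUnipotent_mulVec_sub (t : k) (v : Fin 3 → k) :
    ((sigma32a k p e).toMonoidHom (upperUnipotent t) : Matrix _ _ k).mulVec v - v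
      = ![t ^ p ^ e * v 1 + (t ^ p ^ e) ^ 2 * v 2, 2 * t ^ p ^ e * v 2, 0] := by
  have hp : p ≠ 0 := (Fact.out : p.Prime).ne_zero
  change Matrix.mulVec !![(1 : k) ^ (2 * p ^ e), 1 ^ p ^ e * t ^ p ^ e, t ^ (2 * p ^ e);
    2 * 1 ^ p ^ e * 0 ^ p ^ e, 1 ^ p ^ e * 1 ^ p ^ e + t ^ p ^ e * 0 ^ p ^ e,
      2 * t ^ p ^ e * 1 ^ p ^ e;
    0 ^ (2 * p ^ e), 0 ^ p ^ e * 1 ^ p ^ e, 1 ^ (2 * p ^ e)] v - v = _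
  ext i
  fin_cases i <;>
    simp [dotProduct,
      Fin.sum_univ_three, hp, mul_comm 2 (p ^ e), pow_mul]
  ring

theorem sigma32a_isIndecomposable (hp : 3 ≤ p) : (sigma32a k p e).IsIndecomposable := by
  -- Odd characteristic enters only here: it keeps the coordinate `2 * v 2` below from vanishing.
  have two_ne : (2 : k) ≠ 0 := Ring.two_ne_zero (by rw [ringChar.eq k p]; omega)
  refine SLHom.isIndecomposable_of_mem (e := ![1, 0, 0]) (fun h => by simpa using congrFun h 0)
    fun U v hv hv0 => ?_
  -- Once the last coordinate is zero, either `w` is a multiple of `![1, 0, 0]` or one unipotent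
  -- difference gives `w 1` times it.
  have hfix : ∀ w ∈ U, w 2 = 0 → w ≠ 0 → ![1, 0, 0] ∈ U := fun w hw h2 hw0 => by
    by_cases h1 : w 1 = 0
    · have h0 : w 0 ≠ 0 := fun h => hw0 (by ext i; fin_cases i <;> simp [h, h1, h2])
      refine SLHom.mem_of_smul_mem U h0 ?_
      convert hw using 1
      ext i; fin_cases i <;> simp [h1, h2]
    · refine SLHom.mem_of_smul_mem U h1 ?_
      have := SLHom.mulVec_sub_mem U (upperUnipotent 1) hw
      rw [sigma32a_upperUnipotent_mulVec_sub] at this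
      simpa [h2] using this
  by_cases h2 : v 2 = 0
  · exact hfix v hv h2 hv0
  -- The difference has last coordinate `0` and middle coordinate `2 * v 2 ≠ 0`, so `hfix` applies
  -- to it.
  · have := SLHom.mulVec_sub_mem U (upperUnipotent 1) hv
    rw [sigma32a_upperUnipotent_mulVec_sub] at this
    refine hfix _ this (by simp) fun h => ?_
    have := congrFun h 1
    simp [two_ne, h2] at this

end Indecomposability

/-! ### Splitting of the block-diagonal and trivial homomorphisms. -/

section Decomposition

variable {k : Type*} [Field k]

theorem SLHom.ext_entries {m n : ℕ} {σ τ : SLHom k m n}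
    (h : ∀ A i j, σ.toMonoidHom A i j = τ.toMonoidHom A i j) : σ = τ :=
  SLHom.ext (MonoidHom.ext fun A => Subtype.ext (Matrix.ext (h A)))

/-- The trivial homomorphisms are additive in the dimension. -/
theorem SLHom.triv_add (m n n' : ℕ) :
    SLHom.triv k m (n + n') = (SLHom.triv k m n).directSum (SLHom.triv k m n') := by
  refine SLHom.ext (MonoidHom.ext fun A => Subtype.ext ?_)
  change (1 : Matrix (Fin (n + n')) (Fin (n + n')) k) =
    Matrix.reindex finSumFinEquiv finSumFinEquiv (Matrix.fromBlocks 1 0 0 1)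
  rw [Matrix.fromBlocks_one, Matrix.reindex_apply, Matrix.submatrix_one_equiv]

theorem sigma31c_eq_directSum (p : ℕ) [Fact p.Prime] [CharP k p] (e : ℕ) :
    sigma31c k p e = (sigma21 k p e).directSum (sigma1 k) := by
  refine SLHom.ext_entries fun A i j => ?_
  -- On concrete indices `finSumFinEquiv` and the blocks evaluate, so each entry agrees by
  -- computation.
  fin_cases i <;> fin_cases j <;> rfl

end Decomposition

theorem theorem7p3 {k : Type*} [Field k] [IsAlgClosed k] (p : ℕ) [Fact p.Prime] [CharP k p] :
    (sigma1 k).IsIndecomposable ∧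
    (∀ e : ℕ, (sigma21 k p e).IsIndecomposable) ∧
    (sigma22 k = (sigma1 k).directSum (sigma1 k) ∧ (sigma1 k).IsIndecomposable) ∧
    (∀ hp : p = 2, ∀ e : ℕ,
      (sigma31a k p hp e).IsIndecomposable ∧
      (sigma31b k p hp e).IsIndecomposable ∧
      (sigma31c k p e = (sigma21 k p e).directSum (sigma1 k) ∧
        (sigma21 k p e).IsIndecomposable ∧ (sigma1 k).IsIndecomposable) ∧
      (sigma31d k = ((sigma1 k).directSum (sigma1 k)).directSum (sigma1 k) ∧
        (sigma1 k).IsIndecomposable)) ∧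
    (3 ≤ p → ∀ e : ℕ,
      (sigma32a k p e).IsIndecomposable ∧
      (sigma32b k p e = (sigma21 k p e).directSum (sigma1 k) ∧
        (sigma21 k p e).IsIndecomposable ∧ (sigma1 k).IsIndecomposable) ∧
      (sigma32c k = ((sigma1 k).directSum (sigma1 k)).directSum (sigma1 k) ∧
        (sigma1 k).IsIndecomposable)) := by
  have h1 := sigma1_isIndecomposable (k := k)
  have h21 := sigma21_isIndecomposable (k := k) p
  -- Serves every characteristic, since `sigma32b` unfolds to `sigma31c`.
  have hc := sigma31c_eq_directSum (k := k) p
  have htriv : SLHom.triv k 2 3 = ((sigma1 k).directSum (sigma1 k)).directSum (sigma1 k) := by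
    -- Splitting `3` as `(1 + 1) + 1` matches the bracketing of the sum; `sigma1` unfolds to `triv k
    -- 2 1`.
    rw [SLHom.triv_add 2 2 1, SLHom.triv_add 2 1 1]
    rfl
  exact ⟨h1, h21, ⟨SLHom.triv_add 2 1 1, h1⟩,
    fun hp e => ⟨sigma31a_isIndecomposable p e hp, sigma31b_isIndecomposable p e hp,
      ⟨hc e, h21 e, h1⟩, htriv, h1⟩,
    fun hp e => ⟨sigma32a_isIndecomposable p e hp, ⟨hc e, h21 e, h1⟩, htriv, h1⟩⟩
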